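/- Let $r\ge 0$ and let $\alpha=(\alpha_1,\dots,\alpha_r)$, $\beta=(\beta_1,\dots,\beta_r)$ be tuples of elements of $\mathbb{Q}\setminus\mathbb{Z}_{\le 0}$. Put $$F_{\alpha,\beta}(x)=\sum_{n\ge 0}\frac{(\alpha_1)_n\cdots(\alpha_r)_n}{(\beta_1)_n\cdots(\beta_r)_n}\,x^n\in\mathbb{Q}[[x]],\qquad (t)_n=t(t+1)\cdots(t+n-1).$$ Assume that $F_{\alpha,\beta}$ is globally bounded, i.e. it has positive radius of convergence and there is a non-zero integer $C$ such that $C\,F_{\alpha,\beta}(Cx)$ has (algebraic) integer coefficients. Let $\mathbb{K}$ be any number field that is Galois over $\mathbb{Q}$ (for instance $\mathbb{K}=\mathbb{Q}$). Then the following are equivalent: (i) $F_{\alpha,\beta}$ is factorial: there are a non-zero $C\in\mathbb{Q}$ and (possibly empty) tuples of positive integers $(e_1,\dots,e_u)$, $(f_1,\dots,f_v)$ such that $F_{\alpha,\beta}(Cx)=\sum_{n\ge 0}\frac{(e_1n)!\cdots(e_un)!}{(f_1n)!\cdots(f_vn)!}x^n$; (ii) $F_{\alpha,\beta}$, viewed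 in $\mathbb{K}((x))$, has the Gauss property; (iii) $F_{\alpha,\beta}$, viewed in $\mathbb{K}((x))$, has the Cartier property. Here, for a non-zero prime ideal $\mathfrak{p}$ of $\mathcal{O}_{\mathbb{K}}$ that is unramified over the rational prime $p$ below it, let $\tau_{\mathfrak{p}}\in\mathrm{Gal}(\mathbb{K}/\mathbb{Q})$ be the Frobenius element at $\mathfrak{p}$, i.e. the unique automorphism with $\tau_{\mathfrak{p}}(x)\equiv x^p \bmod \mathfrak{p}$ for all $x\in\mathcal{O}_{\mathbb{K}}$, and let $\mathcal{O}_{\mathbb{K},\mathfrak{p}}\subset\mathbb{K}$ be the localization of $\mathcal{O}_{\mathbb{K}}$ at $\mathfrak{p}$. A Laurent series $\sum_n a_nx^n\in\mathbb{K}((x))$, with $a_n$ extended by $0$ to all $n\in\mathbb{Z}$, has the Gauss property if, for all but finitely many primes $\mathfrak{p}$, one has $a_{np}-\tau_{\mathfrak{p}}(a_n)\in np\,\mathcal{O}_{\mathbb{K},\mathfrak{p}}$ for every $n\in\mathbb{Z}$; it has the Cartier property if, for all but finitely many primes $\mathfrak{p}$, one has $a_{np}-\tau_{\mathfrak{p}}(a_n)\in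 p\,\mathcal{O}_{\mathbb{K},\mathfrak{p}}$ for every $n\in\mathbb{Z}$. (Primes ramified over $\mathbb{Q}$ are finitely many and count among the exceptions.) -/

import Mathlib

open scoped NumberField nonZeroDivisors Nat
open IsDedekindDomain (HeightOneSpectrum)

namespace GaussCartier

/-! ### Hypergeometric series -/

/-- `Q_{α,β}(n) = ((α₁)_n ⋯ (α_r)_n) / ((β₁)_n ⋯ (β_s)_n)`, where `(x)_n = x (x+1) ⋯ (x+n-1)`. -/
noncomputable def hypCoeff {r s : ℕ} (α : Fin r → ℚ) (β : Fin s → ℚ) (n : ℕ) : ℚ :=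
  (∏ i, (ascPochhammer ℚ n).eval (α i)) / (∏ j, (ascPochhammer ℚ n).eval (β j))

/-- `F_{α,β}(x) = ∑ Q_{α,β}(n) xⁿ`. -/
noncomputable def hypSeries {r s : ℕ} (α : Fin r → ℚ) (β : Fin s → ℚ) : PowerSeries ℚ :=
  PowerSeries.mk (hypCoeff α β)

/-- A series `F` is factorial if, for some nonzero rational `C` and positive integers
`e₁, …, e_u, f₁, …, f_v`, one has `F(C x) = ∑ (e₁n)! ⋯ (e_u n)! / ((f₁n)! ⋯ (f_v n)!) xⁿ`. -/
def IsFactorial (F : PowerSeries ℚ) : Prop :=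
  ∃ C : ℚ, C ≠ 0 ∧ ∃ (u v : ℕ) (e : Fin u → ℕ) (f : Fin v → ℕ),
    (∀ i, 0 < e i) ∧ (∀ j, 0 < f j) ∧
    PowerSeries.rescale C F = PowerSeries.mk fun n =>
      (∏ i, ((e i * n)! : ℚ)) / (∏ j, ((f j * n)! : ℚ))

/-- A power series (over the algebraic numbers in `ℂ`) is globally bounded if it has positive
radius of convergence and `C f(C z)` has algebraic integer coefficients for some nonzero
integer `C`. The last condition forces the coefficients of `f` to be algebraic. -/
def IsGloballyBounded (f : PowerSeries ℂ) : Prop :=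
  0 < (FormalMultilinearSeries.ofScalars ℂ fun n => PowerSeries.coeff n f).radius ∧
  ∃ C : ℤ, C ≠ 0 ∧ ∀ n : ℕ,
    IsIntegral ℤ (PowerSeries.coeff n ((C : ℂ) • PowerSeries.rescale (C : ℂ) f))

/-! ### Gauss and Cartier congruences over Galois number fields -/

section Congruences

variable {K : Type*} [Field K] [NumberField K]

/-- The rational prime `p` below `𝔭`. -/
noncomputable def residueChar (𝔭 : HeightOneSpectrum (𝓞 K)) : ℕ :=
  ringChar (𝓞 K ⧸ 𝔭.asIdeal)

/-- The localization `𝓞_{K,𝔭}`, as a subalgebra of `K`. -/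
noncomputable def localRing (𝔭 : HeightOneSpectrum (𝓞 K)) : Subalgebra (𝓞 K) K :=
  Localization.subalgebra.ofField K 𝔭.asIdeal.primeCompl 𝔭.asIdeal.primeCompl_le_nonZeroDivisors

/-- `𝔭` is unramified over `ℚ`. -/
def IsUnramified (𝔭 : HeightOneSpectrum (𝓞 K)) : Prop :=
  Algebra.IsUnramifiedAt ℤ 𝔭.asIdeal

/-- A Frobenius element at `𝔭`: an automorphism `τ` of `K` with `τ x ≡ x ^ p mod 𝔭` for all
`x ∈ 𝓞 K`. If `𝔭` is unramified, it is the only such automorphism. -/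
noncomputable def frobeniusAt [IsGalois ℚ K] (𝔭 : HeightOneSpectrum (𝓞 K)) : K ≃ₐ[ℚ] K :=
  haveI : Finite (𝓞 K ⧸ 𝔭.asIdeal) := Ideal.finiteQuotientOfFreeOfNeBot _ 𝔭.ne_bot
  arithFrobAt ℤ (K ≃ₐ[ℚ] K) 𝔭.asIdeal

/-- Gauss congruences for `𝔭`: `a_{np} - τ_p(a_n) ∈ n p 𝓞_{K,𝔭}` for all integers `n`. -/
def GaussCongruences [IsGalois ℚ K] (a : ℤ → K) (𝔭 : HeightOneSpectrum (𝓞 K)) : Prop :=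
  ∀ n : ℤ, ∃ z ∈ localRing 𝔭,
    a (n * residueChar 𝔭) - frobeniusAt 𝔭 (a n) = (n : K) * (residueChar 𝔭 : K) * z

/-- Cartier congruences for `𝔭`: `a_{np} - τ_p(a_n) ∈ p 𝓞_{K,𝔭}` for all integers `n`. -/
def CartierCongruences [IsGalois ℚ K] (a : ℤ → K) (𝔭 : HeightOneSpectrum (𝓞 K)) : Prop :=
  ∀ n : ℤ, ∃ z ∈ localRing 𝔭,
    a (n * residueChar 𝔭) - frobeniusAt 𝔭 (a n) = (residueChar 𝔭 : K) * z

/-- The Gauss property of a Laurent series: its bilateral coefficient sequence satisfies Gauss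
congruences for all but finitely many primes of `𝓞 K` (the finitely many ramified primes
are among the exceptions). -/
def HasGaussProperty [IsGalois ℚ K] (f : LaurentSeries K) : Prop :=
  ∀ᶠ 𝔭 : HeightOneSpectrum (𝓞 K) in Filter.cofinite,
    IsUnramified 𝔭 ∧ GaussCongruences f.coeff 𝔭

/-- The Cartier property of a Laurent series. -/
def HasCartierProperty [IsGalois ℚ K] (f : LaurentSeries K) : Prop :=
  ∀ᶠ 𝔭 : HeightOneSpectrum (𝓞 K) in Filter.cofinite,
    IsUnramified 𝔭 ∧ CartierCongruences f.coeff 𝔭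

end Congruences

end GaussCartier

/-! The coefficients `Q(n)` are rational, so Frobenius acts trivially and both congruences at `𝔭`
depend only on the rational prime `p` below it. Gauss implies Cartier because `n` is an integer.

Factorial implies Gauss: comparing degrees in `Q(n+1)/Q(n)` forces `∑ e = ∑ f`. Write `(mp)! = p^m
m! U(m)` with `U(m)` prime to `p`. The powers of `p` cancel, and `U(en) ≡ U(n)^e` mod `np`
(`factorialUnit_mul`) makes the quotient of unit parts congruent to 1. Global boundedness makes
`Q(n)` `p`-integral for almost all `p`.

Cartier implies factorial: over a common denominator `d`, Pochhammer symbols become products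
`P(a,n)` along progressions of step `d`. For large `p` with `pw ≡ 1` mod `d`, the multiples of `p`
in `P(a,np)` form `p^n P(a',n)`, where `a'` in `[1,d]` represents `wa`; the other factors contribute
a power of the product of nonzero residues, the same for every parameter. Cartier thus gives a
congruence mod `p` between integers depending only on `w` and `n`, and Dirichlet's theorem turns it
into an equality (`prod_progressionProd_eq_of_cartier`). Varying `n` yields an equality of
multisets. Hence the signed multiplicity `m(k)` of a numerator `k` lives on `[1,d]` and depends only
on `gcd(k,d)`. Möbius inversion then writes `Q` as a product of powers of `∏ P(k,n)` over the
multiples `k ≤ d` of `h`, for `h ∣ d`, and each such product is `h^(en) (en)!` with `e = d/h`. -/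

namespace GaussCartier

/-! ### Congruences over `K` for rational series, in terms of integers -/

section LocalRings

variable {K : Type*} [Field K]

theorem charP_residueChar (𝔭 : HeightOneSpectrum (𝓞 K)) :
    CharP (𝓞 K ⧸ 𝔭.asIdeal) (residueChar 𝔭) :=
  ringChar.charP _

theorem intCast_mem_asIdeal_iff (𝔭 : HeightOneSpectrum (𝓞 K)) (m : ℤ) :
    (m : 𝓞 K) ∈ 𝔭.asIdeal ↔ (residueChar 𝔭 : ℤ) ∣ m := by
  have := charP_residueChar 𝔭
  rw [← CharP.intCast_eq_zero_iff (𝓞 K ⧸ 𝔭.asIdeal), ← Ideal.Quotient.eq_zero_iff_mem, map_intCast]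

variable [NumberField K]

theorem residueChar_prime (𝔭 : HeightOneSpectrum (𝓞 K)) : (residueChar 𝔭).Prime := by
  have : Finite (𝓞 K ⧸ 𝔭.asIdeal) := Ideal.finiteQuotientOfFreeOfNeBot _ 𝔭.ne_bot
  have := 𝔭.isPrime
  have := charP_residueChar 𝔭
  exact CharP.char_is_prime (𝓞 K ⧸ 𝔭.asIdeal) _

theorem ratCast_mem_localRing_iff (𝔭 : HeightOneSpectrum (𝓞 K)) (q : ℚ) :
    (q : K) ∈ localRing 𝔭 ↔ ∃ s w : ℤ, ¬ (residueChar 𝔭 : ℤ) ∣ s ∧ q * s = w := by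
  have := 𝔭.isPrime
  constructor
  · rintro ⟨a, σ, hσ, h⟩
    refine ⟨q.den, q.num, fun hd => ?_, by simp⟩
    have hσ0 : algebraMap (𝓞 K) K σ ≠ 0 := by
      rw [Ne, map_eq_zero_iff _ (FaithfulSMul.algebraMap_injective (𝓞 K) K)]
      rintro rfl
      exact hσ (Ideal.zero_mem _)
    have hq : (q : K) * (q.den : K) = (q.num : K) := by exact_mod_cast Rat.mul_den_eq_num q
    have hK : ((q.num : ℤ) : 𝓞 K) * σ = ((q.den : ℤ) : 𝓞 K) * a := by
      apply FaithfulSMul.algebraMap_injective (𝓞 K) K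
      rw [map_mul, map_mul, map_intCast, map_intCast, ← hq, h]
      push_cast
      field_simp
    have hmem : ((q.num : ℤ) : 𝓞 K) * σ ∈ 𝔭.asIdeal := by
      rw [hK]
      exact Ideal.mul_mem_right _ _ ((intCast_mem_asIdeal_iff 𝔭 _).2 hd)
    have hnum := (intCast_mem_asIdeal_iff 𝔭 _).1
      (((Ideal.IsPrime.mem_or_mem ‹_› hmem).resolve_right hσ))
    have h1 : residueChar 𝔭 ∣ q.num.natAbs := Int.natCast_dvd.1 hnum
    have h2 : residueChar 𝔭 ∣ q.den := by exact_mod_cast hd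
    exact (residueChar_prime 𝔭).one_lt.ne' (Nat.eq_one_of_dvd_coprimes q.reduced h1 h2)
  · rintro ⟨s, w, hs, h⟩
    have hs0 : (s : ℚ) ≠ 0 := by
      rw [Int.cast_ne_zero]
      rintro rfl
      exact hs (dvd_zero _)
    refine ⟨(w : 𝓞 K), (s : 𝓞 K), fun hm => hs ((intCast_mem_asIdeal_iff 𝔭 _).1 hm), ?_⟩
    rw [map_intCast, map_intCast, eq_div_of_mul_eq hs0 h, div_eq_mul_inv]
    push_cast
    rfl

theorem exists_mem_localRing_eq_mul_iff (𝔭 : HeightOneSpectrum (𝓞 K)) (q c : ℚ) (hc : c ≠ 0) :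
    (∃ z ∈ localRing 𝔭, (q : K) = (c : K) * z) ↔
      ∃ s w : ℤ, ¬ (residueChar 𝔭 : ℤ) ∣ s ∧ q * s = c * w := by
  have hcK : (c : K) ≠ 0 := by exact_mod_cast hc
  have hz : (∃ z ∈ localRing 𝔭, (q : K) = (c : K) * z) ↔ ((q / c : ℚ) : K) ∈ localRing 𝔭 := by
    constructor
    · rintro ⟨z, hz, h⟩
      rw [Rat.cast_div, h, mul_div_cancel_left₀ _ hcK]
      exact hz
    · intro h
      refine ⟨_, h, ?_⟩
      rw [Rat.cast_div, mul_div_cancel₀ _ hcK]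
  rw [hz, ratCast_mem_localRing_iff]
  refine exists_congr fun s => exists_congr fun w => and_congr_right fun _ => ?_
  field_simp

theorem coeff_map_intCast (F : PowerSeries ℚ) (n : ℕ) :
    ((F.map (algebraMap ℚ K) : PowerSeries K) : LaurentSeries K).coeff (n : ℤ) =
      ((PowerSeries.coeff n F : ℚ) : K) := by
  simp [PowerSeries.coeff_coe]

theorem coeff_map_of_neg (F : PowerSeries ℚ) {n : ℤ} (hn : n < 0) :
    ((F.map (algebraMap ℚ K) : PowerSeries K) : LaurentSeries K).coeff n = 0 := by
  simp [PowerSeries.coeff_coe, hn]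

variable [IsGalois ℚ K]

theorem coeff_sub_frobenius (F : PowerSeries ℚ) (𝔭 : HeightOneSpectrum (𝓞 K)) (n : ℕ) :
    ((F.map (algebraMap ℚ K) : PowerSeries K) : LaurentSeries K).coeff (n * residueChar 𝔭) -
      frobeniusAt 𝔭 (((F.map (algebraMap ℚ K) : PowerSeries K) : LaurentSeries K).coeff n) =
    ((PowerSeries.coeff (n * residueChar 𝔭) F - PowerSeries.coeff n F : ℚ) : K) := by
  rw [coeff_map_intCast, map_ratCast, ← Nat.cast_mul, coeff_map_intCast, Rat.cast_sub]

/-- Reduces the condition at `𝔭` to one on `p` alone: Frobenius fixes rational coefficients, and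
negative indices contribute nothing. -/
theorem cartierCongruences_iff (F : PowerSeries ℚ) (𝔭 : HeightOneSpectrum (𝓞 K)) :
    CartierCongruences
      ((F.map (algebraMap ℚ K) : PowerSeries K) : LaurentSeries K).coeff 𝔭 ↔
    ∀ n : ℕ, ∃ s w : ℤ, ¬ (residueChar 𝔭 : ℤ) ∣ s ∧
      (PowerSeries.coeff (n * residueChar 𝔭) F - PowerSeries.coeff n F) * s =
        residueChar 𝔭 * w := by
  have hp := residueChar_prime 𝔭
  have key (n : ℕ) := exists_mem_localRing_eq_mul_iff 𝔭
    (PowerSeries.coeff (n * residueChar 𝔭) F - PowerSeries.coeff n F) (residueChar 𝔭)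
    (by exact_mod_cast hp.ne_zero)
  simp only [Rat.cast_natCast] at key
  constructor
  · intro h n
    rw [← key]
    simpa only [coeff_sub_frobenius] using h n
  · intro h n
    obtain ⟨m, rfl | rfl⟩ := n.eq_nat_or_neg
    · simpa only [coeff_sub_frobenius] using (key m).2 (h m)
    · rcases m.eq_zero_or_pos with rfl | hm
      · refine ⟨0, Subalgebra.zero_mem _, ?_⟩
        have := coeff_sub_frobenius F 𝔭 0
        simpa using this
      · refine ⟨0, Subalgebra.zero_mem _, ?_⟩
        rw [coeff_map_of_neg, coeff_map_of_neg]
        · simp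
        · omega
        · have := hp.pos
          nlinarith

theorem gaussCongruences_of (F : PowerSeries ℚ) (𝔭 : HeightOneSpectrum (𝓞 K))
    (h : ∀ n : ℕ, 0 < n → ∃ s w : ℤ, ¬ (residueChar 𝔭 : ℤ) ∣ s ∧
      (PowerSeries.coeff (n * residueChar 𝔭) F - PowerSeries.coeff n F) * s =
        n * residueChar 𝔭 * w) :
    GaussCongruences
      ((F.map (algebraMap ℚ K) : PowerSeries K) : LaurentSeries K).coeff 𝔭 := by
  have hp := residueChar_prime 𝔭
  intro n
  obtain ⟨m, rfl | rfl⟩ := n.eq_nat_or_neg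
  · rcases m.eq_zero_or_pos with rfl | hm
    · refine ⟨0, Subalgebra.zero_mem _, ?_⟩
      have := coeff_sub_frobenius F 𝔭 0
      simpa using this
    · have key := (exists_mem_localRing_eq_mul_iff 𝔭
        (PowerSeries.coeff (m * residueChar 𝔭) F - PowerSeries.coeff m F) (m * residueChar 𝔭)
        (by exact_mod_cast (Nat.mul_pos hm hp.pos).ne')).2 (h m hm)
      rw [coeff_sub_frobenius]
      simpa using key
  · rcases m.eq_zero_or_pos with rfl | hm
    · refine ⟨0, Subalgebra.zero_mem _, ?_⟩
      have := coeff_sub_frobenius F 𝔭 0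
      simpa using this
    · refine ⟨0, Subalgebra.zero_mem _, ?_⟩
      rw [coeff_map_of_neg, coeff_map_of_neg]
      · simp
      · omega
      · have := hp.pos
        nlinarith

theorem HasGaussProperty.hasCartierProperty {f : LaurentSeries K} (h : HasGaussProperty f) :
    HasCartierProperty f := by
  filter_upwards [h] with 𝔭 h𝔭
  refine ⟨h𝔭.1, fun n => ?_⟩
  obtain ⟨z, hz, h⟩ := h𝔭.2 n
  refine ⟨(n : K) * z, ?_, ?_⟩
  · exact Subalgebra.mul_mem _ (by exact_mod_cast Subalgebra.intCast_mem _ n) hz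
  · rw [h]
    ring

end LocalRings

/-! ### Exceptional primes -/

section Finiteness

variable {K : Type*} [Field K] [NumberField K]

theorem eventually_not_residueChar_dvd (B : ℤ) (hB : B ≠ 0) :
    ∀ᶠ 𝔭 : HeightOneSpectrum (𝓞 K) in Filter.cofinite, ¬ (residueChar 𝔭 : ℤ) ∣ B := by
  have hne : Ideal.span {(B : 𝓞 K)} ≠ ⊥ := by
    rw [Ne, Ideal.span_singleton_eq_bot]
    exact_mod_cast hB
  refine (Ideal.finite_factors hne).subset fun 𝔭 h => ?_
  simp only [Set.mem_compl_iff, Set.mem_ofPred_eq, not_not] at h ⊢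
  rw [Ideal.dvd_span_singleton, intCast_mem_asIdeal_iff]
  exact h

theorem eventually_isUnramified :
    ∀ᶠ 𝔭 : HeightOneSpectrum (𝓞 K) in Filter.cofinite, IsUnramified 𝔭 := by
  have hne : differentIdeal ℤ (𝓞 K) ≠ ⊥ := differentIdeal_ne_bot
  refine (Ideal.finite_factors hne).subset fun 𝔭 h => ?_
  by_contra hd
  have := 𝔭.isPrime
  exact h (not_dvd_differentIdeal_iff.1 hd)

theorem exists_residueChar_eq {p : ℕ} (hp : p.Prime) :
    ∃ 𝔭 : HeightOneSpectrum (𝓞 K), residueChar 𝔭 = p := by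
  have hne : ¬ IsUnit ((p : ℤ) : 𝓞 K) := by
    intro h
    have := h.map (Algebra.norm ℤ)
    rw [show ((p : ℤ) : 𝓞 K) = algebraMap ℤ (𝓞 K) p by simp, Algebra.norm_algebraMap] at this
    have h2 := (isUnit_pow_iff (Module.finrank_pos (R := ℤ) (M := 𝓞 K)).ne').1 this
    exact (Nat.prime_iff_prime_int.1 hp).not_isUnit h2
  obtain ⟨M, hM, hmem⟩ := exists_max_ideal_of_mem_nonunits hne
  have hbot : M ≠ ⊥ := by
    rintro rfl
    have : ((p : ℤ) : 𝓞 K) = 0 := hmem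
    have : (p : ℤ) = 0 := by exact_mod_cast this
    exact hp.ne_zero (by exact_mod_cast this)
  refine ⟨⟨M, hM.isPrime, hbot⟩, ?_⟩
  have h := (intCast_mem_asIdeal_iff (⟨M, hM.isPrime, hbot⟩ : HeightOneSpectrum (𝓞 K)) p).1 hmem
  exact (Nat.prime_dvd_prime_iff_eq (residueChar_prime _) hp).1 (by exact_mod_cast h)

/-- Finitely many bad `𝔭` lie over finitely many `p`. One good prime above each large `p` suffices
later, since for rational series the congruences depend only on `p`. -/
theorem exists_forall_prime_gt_of_eventually {P : HeightOneSpectrum (𝓞 K) → Prop}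
    (h : ∀ᶠ 𝔭 in Filter.cofinite, P 𝔭) :
    ∃ N : ℕ, ∀ p : ℕ, p.Prime → N < p → ∃ 𝔭, residueChar 𝔭 = p ∧ P 𝔭 := by
  have hfin : (residueChar '' {𝔭 : HeightOneSpectrum (𝓞 K) | ¬ P 𝔭}).Finite :=
    Set.Finite.image _ h
  obtain ⟨N, hN⟩ := hfin.bddAbove
  refine ⟨N, fun p hp hlt => ?_⟩
  obtain ⟨𝔭, h𝔭⟩ := exists_residueChar_eq (K := K) hp
  refine ⟨𝔭, h𝔭, ?_⟩
  by_contra hP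
  have := hN ⟨𝔭, hP, rfl⟩
  omega

end Finiteness

/-! ### Equality of the factorial weights -/

section FactorialGrowth

theorem factorial_mul_succ (e n : ℕ) :
    (e * (n + 1))! = (e * n)! * ∏ j ∈ Finset.range e, (e * n + j + 1) := by
  have key (m k : ℕ) : (m + k)! = m ! * ∏ j ∈ Finset.range k, (m + j + 1) := by
    induction k with
    | zero => simp
    | succ k ih => rw [← add_assoc, Nat.factorial_succ, ih, Finset.prod_range_succ]; ring
  rw [mul_add, mul_one, key]

open Polynomial in
theorem natDegree_prod_linear {u : ℕ} (e : Fin u → ℕ) (he : ∀ i, 0 < e i) :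
    (∏ i, ∏ j ∈ Finset.range (e i), (C (e i : ℚ) * X + C ((j : ℚ) + 1))).natDegree = ∑ i, e i := by
  have hlin (i : Fin u) (j : ℕ) : (C (e i : ℚ) * X + C ((j : ℚ) + 1)).natDegree = 1 :=
    natDegree_linear (by exact_mod_cast (he i).ne')
  have hne (i : Fin u) (j : ℕ) : C (e i : ℚ) * X + C ((j : ℚ) + 1) ≠ 0 :=
    ne_zero_of_natDegree_gt (n := 0) (by rw [hlin]; exact one_pos)
  rw [natDegree_prod _ _ fun i _ => Finset.prod_ne_zero_iff.2 fun j _ => hne i j]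
  refine Finset.sum_congr rfl fun i _ => ?_
  rw [natDegree_prod _ _ fun j _ => hne i j]
  rw [Finset.sum_congr rfl fun j _ => hlin i j]
  simp

theorem hypCoeff_succ {r s : ℕ} (α : Fin r → ℚ) (β : Fin s → ℚ) (n : ℕ) :
    hypCoeff α β (n + 1) = hypCoeff α β n * ((∏ i, (α i + n)) / ∏ i, (β i + n)) := by
  simp only [hypCoeff, ascPochhammer_succ_eval, Finset.prod_mul_distrib]
  rw [mul_div_mul_comm]

theorem add_natCast_ne_zero {x : ℚ} (hx : ∀ m : ℕ, x ≠ -(m : ℚ)) (n : ℕ) : x + n ≠ 0 :=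
  fun h => hx n (eq_neg_of_add_eq_zero_left h)

open Polynomial in
-- Ratios of consecutive terms agree at every natural number, hence as rational functions. As `α`
-- and `β` have the same length, comparing degrees after clearing denominators leaves `∑ e = ∑ f`.
theorem sum_eq_sum_of_hypCoeff_eq {r : ℕ} {α β : Fin r → ℚ}
    (hβ : ∀ i (m : ℕ), β i ≠ -(m : ℚ)) {C₀ : ℚ} (hC : C₀ ≠ 0) {u v : ℕ}
    {e : Fin u → ℕ} {f : Fin v → ℕ} (he : ∀ i, 0 < e i) (hf : ∀ j, 0 < f j)
    (h : ∀ n : ℕ, C₀ ^ n * hypCoeff α β n = (∏ i, ((e i * n)! : ℚ)) / ∏ j, ((f j * n)! : ℚ)) :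
    ∑ i, e i = ∑ j, f j := by
  have hpoly : C C₀ * (∏ i, (X + C (α i))) *
        ∏ i, ∏ j ∈ Finset.range (f i), (C (f i : ℚ) * X + C ((j : ℚ) + 1)) =
      (∏ i, (X + C (β i))) *
        ∏ i, ∏ j ∈ Finset.range (e i), (C (e i : ℚ) * X + C ((j : ℚ) + 1)) := by
    refine eq_of_infinite_eval_eq _ _ ((Set.infinite_range_of_injective
      (Nat.cast_injective (R := ℚ))).mono ?_)
    rintro _ ⟨n, rfl⟩
    have hfac {w : ℕ} (g : Fin w → ℕ) : ∏ i, ((g i * (n + 1))! : ℚ) =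
        (∏ i, ((g i * n)! : ℚ)) * ∏ i, ∏ j ∈ Finset.range (g i), ((g i : ℚ) * n + (j + 1)) := by
      rw [← Finset.prod_mul_distrib]
      refine Finset.prod_congr rfl fun i _ => ?_
      rw [factorial_mul_succ]
      push_cast
      simp only [add_assoc]
    have h1 := h (n + 1)
    rw [hypCoeff_succ, hfac, hfac, mul_div_mul_comm, ← h n] at h1
    have hpos {w : ℕ} (g : Fin w → ℕ) : (∏ i, ((g i * n)! : ℚ)) ≠ 0 :=
      Finset.prod_ne_zero_iff.2 fun i _ => by exact_mod_cast (Nat.factorial_pos _).ne'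
    have hQ : C₀ ^ n * hypCoeff α β n ≠ 0 := by
      rw [h n]
      exact div_ne_zero (hpos e) (hpos f)
    have hb : ∏ i, (β i + n) ≠ 0 :=
      Finset.prod_ne_zero_iff.2 fun i _ => add_natCast_ne_zero (hβ i) n
    have hF : (∏ i, ∏ j ∈ Finset.range (f i), ((f i : ℚ) * n + (j + 1))) ≠ 0 :=
      Finset.prod_ne_zero_iff.2 fun i _ => Finset.prod_ne_zero_iff.2 fun j _ => by positivity
    rw [show C₀ ^ (n + 1) * (hypCoeff α β n * ((∏ i, (α i + n)) / ∏ i, (β i + n))) =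
      C₀ ^ n * hypCoeff α β n * (C₀ * (∏ i, (α i + n)) / ∏ i, (β i + n)) by ring] at h1
    have h2 := mul_left_cancel₀ hQ h1
    rw [div_eq_div_iff hb hF] at h2
    simp only [Set.mem_ofPred_eq, eval_mul, eval_prod, eval_add, eval_C, eval_X]
    simp only [add_comm (n : ℚ) (α _), add_comm (n : ℚ) (β _)]
    rw [h2]
    ring
  have hmon (γ : Fin r → ℚ) : (∏ i, (X + C (γ i))).Monic :=
    monic_prod_of_monic _ _ fun i _ => monic_X_add_C _
  have hdegγ (γ : Fin r → ℚ) : (∏ i, (X + C (γ i))).natDegree = r := by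
    rw [natDegree_prod_of_monic _ _ fun i _ => monic_X_add_C _]
    simp
  have hne {w : ℕ} (g : Fin w → ℕ) (hg : ∀ i, 0 < g i) :
      (∏ i, ∏ j ∈ Finset.range (g i), (C (g i : ℚ) * X + C ((j : ℚ) + 1))) ≠ 0 :=
    Finset.prod_ne_zero_iff.2 fun i _ => Finset.prod_ne_zero_iff.2 fun j _ =>
      ne_zero_of_natDegree_gt (n := 0) (by
        rw [natDegree_linear (by exact_mod_cast (hg i).ne')]
        exact one_pos)
  have hdeg := congrArg natDegree hpoly
  rw [mul_assoc, natDegree_C_mul hC, natDegree_mul (hmon α).ne_zero (hne f hf),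
    natDegree_mul (hmon β).ne_zero (hne e he), hdegγ, hdegγ, natDegree_prod_linear e he,
    natDegree_prod_linear f hf] at hdeg
  omega

end FactorialGrowth

/-! ### Congruences for the prime-to-`p` part of factorials -/

section FactorialCongruences

/-- The product of the integers in `[1, m p]` that are prime to `p`. -/
def factorialUnit (p m : ℕ) : ℕ :=
  ∏ t ∈ Finset.range m, ∏ j ∈ Finset.range (p - 1), (p * t + j + 1)

theorem factorial_mul_prime {p : ℕ} (hp : 0 < p) (m : ℕ) :
    (m * p)! = p ^ m * m ! * factorialUnit p m := by
  induction m with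
  | zero => simp [factorialUnit]
  | succ m ih =>
    have h : ∏ j ∈ Finset.range p, (p * m + j + 1) =
        (∏ j ∈ Finset.range (p - 1), (p * m + j + 1)) * (p * (m + 1)) := by
      conv_lhs => rw [← Nat.sub_add_cancel hp, Finset.prod_range_succ]
      rw [Nat.sub_add_cancel hp, add_assoc (p * m), Nat.sub_add_cancel hp]
      rfl
    rw [mul_comm, factorial_mul_succ, mul_comm p m, ih, mul_comm m p, h, factorialUnit,
      factorialUnit, Finset.prod_range_succ, Nat.factorial_succ]
    ring

theorem prime_not_dvd_factorialUnit {p : ℕ} (hp : p.Prime) (m : ℕ) : ¬ p ∣ factorialUnit p m := by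
  rw [factorialUnit, hp.prime.dvd_finsetProd_iff]
  rintro ⟨t, -, h⟩
  rw [hp.prime.dvd_finsetProd_iff] at h
  obtain ⟨j, hj, h⟩ := h
  rw [add_assoc, Nat.dvd_add_right (dvd_mul_right _ _)] at h
  have := Nat.le_of_dvd (by omega) h
  have := Finset.mem_range.1 hj
  omega

/-- The factors split into `e` blocks of `n` values of `t`; shifting `t` by `n` changes `p * t` by a
multiple of `np`, so all blocks agree. -/
theorem factorialUnit_mul (p n e : ℕ) :
    (factorialUnit p (e * n) : ZMod (n * p)) = (factorialUnit p n : ZMod (n * p)) ^ e := by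
  have hper (m x j : ℕ) : (p * (m * n + x) + j + 1 : ZMod (n * p)) = p * x + j + 1 := by
    have h : (n * p : ZMod (n * p)) = 0 := by exact_mod_cast ZMod.natCast_self (n * p)
    linear_combination (m : ZMod (n * p)) * h
  induction e with
  | zero => simp [factorialUnit]
  | succ e ih =>
    rw [pow_succ, ← ih, factorialUnit, factorialUnit, factorialUnit, add_mul, one_mul,
      Finset.prod_range_add]
    push_cast
    simp only [hper]

theorem dvd_prod_factorialUnit_sub {p n u v : ℕ} (e : Fin u → ℕ) (f : Fin v → ℕ)
    (h : ∑ i, e i = ∑ j, f j) :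
    ((n * p : ℕ) : ℤ) ∣ (∏ i, (factorialUnit p (e i * n) : ℤ)) -
      ∏ j, (factorialUnit p (f j * n) : ℤ) := by
  rw [← ZMod.intCast_zmod_eq_zero_iff_dvd]
  push_cast
  simp only [factorialUnit_mul]
  rw [Finset.prod_pow_eq_pow_sum, Finset.prod_pow_eq_pow_sum, h, sub_self]

theorem prod_factorial_mul_prime {p : ℕ} (hp : 0 < p) (n : ℕ) {u : ℕ} (e : Fin u → ℕ) :
    ∏ i, ((e i * (n * p))! : ℚ) = p ^ ((∑ i, e i) * n) * (∏ i, ((e i * n)! : ℚ)) *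
      ∏ i, (factorialUnit p (e i * n) : ℚ) := by
  rw [Finset.sum_mul, ← Finset.prod_pow_eq_pow_sum, ← Finset.prod_mul_distrib,
    ← Finset.prod_mul_distrib]
  refine Finset.prod_congr rfl fun i _ => ?_
  rw [← mul_assoc, factorial_mul_prime hp]
  push_cast
  rfl

/-- Fermat's congruence for `x ^ m`, raised to the power `p ^ k`, gains `k` factors of `p`. -/
theorem prime_pow_dvd_pow_sub_pow {p : ℕ} (hp : p.Prime) (x : ℤ) (k m : ℕ) :
    (p : ℤ) ^ (k + 1) ∣ x ^ (p ^ k * m * p) - x ^ (p ^ k * m) := by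
  have := Fact.mk hp
  have h1 : (p : ℤ) ∣ (x ^ m) ^ p - x ^ m := by
    rw [← ZMod.intCast_zmod_eq_zero_iff_dvd]
    push_cast
    rw [ZMod.pow_card, sub_self]
  have h2 := dvd_sub_pow_of_dvd_sub h1 k
  rw [← pow_mul, ← pow_mul, ← pow_mul, ← mul_assoc] at h2
  rwa [show p ^ k * m * p = m * p * p ^ k by ring, mul_comm (p ^ k)]

end FactorialCongruences

/-! ### Factorial series have the Gauss property -/

section GloballyBounded

theorem IsGloballyBounded.exists_intCast {F : PowerSeries ℚ}
    (hF : IsGloballyBounded (F.map (algebraMap ℚ ℂ))) :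
    ∃ g : ℤ, g ≠ 0 ∧ ∀ n : ℕ, ∃ w : ℤ, PowerSeries.coeff n F * g ^ (n + 1) = w := by
  obtain ⟨-, g, hg, h⟩ := hF
  refine ⟨g, hg, fun n => ?_⟩
  have h1 := h n
  have h2 : PowerSeries.coeff n ((g : ℂ) • PowerSeries.rescale (g : ℂ)
      (F.map (algebraMap ℚ ℂ))) = algebraMap ℚ ℂ (PowerSeries.coeff n F * g ^ (n + 1)) := by
    simp [PowerSeries.coeff_rescale]
    ring
  rw [h2, isIntegral_algebraMap_iff (algebraMap ℚ ℂ).injective] at h1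
  obtain ⟨w, hw⟩ := IsIntegrallyClosed.isIntegral_iff.1 h1
  exact ⟨w, by rw [← hw]; simp⟩

theorem gauss_congruence_of_factorial {r : ℕ} {α β : Fin r → ℚ}
    {x y g : ℤ} (hy : y ≠ 0) {u v : ℕ} {e : Fin u → ℕ} {f : Fin v → ℕ}
    (hsum : ∑ i, e i = ∑ j, f j)
    (h : ∀ n : ℕ, ((x : ℚ) / y) ^ n * hypCoeff α β n =
      (∏ i, ((e i * n)! : ℚ)) / ∏ j, ((f j * n)! : ℚ))
    (hg : ∀ n : ℕ, ∃ w : ℤ, hypCoeff α β n * g ^ (n + 1) = w)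
    {p : ℕ} (hp : p.Prime) (hpB : ¬ (p : ℤ) ∣ x * y * g) {n : ℕ} (hn : 0 < n) :
    ∃ s w : ℤ, ¬ (p : ℤ) ∣ s ∧
      (hypCoeff α β (n * p) - hypCoeff α β n) * s = n * p * w := by
  have hpi := Nat.prime_iff_prime_int.1 hp
  have hfac {w : ℕ} (c : Fin w → ℕ) (m : ℕ) : (∏ i, ((c i * m)! : ℚ)) ≠ 0 :=
    Finset.prod_ne_zero_iff.2 fun i _ => by exact_mod_cast (Nat.factorial_pos _).ne'
  set Ve : ℤ := ∏ i, (factorialUnit p (e i * n) : ℤ) with hVe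
  set Vf : ℤ := ∏ j, (factorialUnit p (f j * n) : ℤ) with hVf
  have hVfp : ¬ (p : ℤ) ∣ Vf := by
    rw [hVf, hpi.dvd_finsetProd_iff]
    rintro ⟨j, -, hj⟩
    exact prime_not_dvd_factorialUnit hp _ (by exact_mod_cast hj)
  have hrel : ((x : ℚ) / y) ^ (n * p) * hypCoeff α β (n * p) * Vf =
      ((x : ℚ) / y) ^ n * hypCoeff α β n * Ve := by
    rw [h, h, prod_factorial_mul_prime hp.pos, prod_factorial_mul_prime hp.pos, hsum, hVe, hVf]
    have h0 := hfac f n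
    have hVf0 : (Vf : ℚ) ≠ 0 := by
      rw [Int.cast_ne_zero]
      exact fun h0 => hVfp (h0 ▸ dvd_zero _)
    rw [hVf] at hVf0
    push_cast at hVf0 ⊢
    have hp0 : (p : ℚ) ≠ 0 := by exact_mod_cast hp.ne_zero
    field_simp
  have hy0 : (y : ℚ) ≠ 0 := by exact_mod_cast hy
  rw [div_pow, div_pow] at hrel
  field_simp at hrel
  obtain ⟨k, n', hn', rfl⟩ := Nat.exists_eq_pow_mul_and_not_dvd hn.ne' p hp.ne_one
  obtain ⟨w₀, hw₀⟩ := hg (p ^ k * n')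
  set n := p ^ k * n' with hndef
  have hcong : (p : ℤ) ^ (k + 1) ∣ x ^ n * y ^ (n * p) * Ve - x ^ (n * p) * y ^ n * Vf := by
    have hx := prime_pow_dvd_pow_sub_pow hp x k n'
    have hy := prime_pow_dvd_pow_sub_pow hp y k n'
    have hV : (p : ℤ) ^ (k + 1) ∣ Ve - Vf := by
      refine dvd_trans ?_ (dvd_prod_factorialUnit_sub e f hsum)
      refine ⟨n', ?_⟩
      push_cast
      ring
    rw [← hndef] at hx hy
    -- Replaces `y ^ (n * p)`, `x ^ (n * p)` and `Ve` in turn, so that each summand carries one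
    -- known congruence.
    have : x ^ n * y ^ (n * p) * Ve - x ^ (n * p) * y ^ n * Vf =
        x ^ n * Ve * (y ^ (n * p) - y ^ n) - y ^ n * Ve * (x ^ (n * p) - x ^ n) +
          x ^ (n * p) * y ^ n * (Ve - Vf) := by ring
    rw [this]
    exact dvd_add (dvd_sub (hy.mul_left _) (hx.mul_left _)) (hV.mul_left _)
  obtain ⟨w, hw⟩ := hcong
  -- The multiplier clears the denominators. Its factor `n'`, prime to `p`, upgrades divisibility by
  -- `p ^ (k + 1)` to divisibility by `n * p`.
  refine ⟨x ^ (n * p) * y ^ n * Vf * g ^ (n + 1) * n', w₀ * w, ?_, ?_⟩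
  · have hpow (z : ℤ) (m : ℕ) (hz : ¬ (p : ℤ) ∣ z) : ¬ (p : ℤ) ∣ z ^ m :=
      fun hd => hz (hpi.dvd_of_dvd_pow hd)
    have hx : ¬ (p : ℤ) ∣ x := fun hd => hpB ((hd.mul_right y).mul_right g)
    have hy : ¬ (p : ℤ) ∣ y := fun hd => hpB ((hd.mul_left x).mul_right g)
    have hg : ¬ (p : ℤ) ∣ g := fun hd => hpB (hd.mul_left _)
    have hn'' : ¬ (p : ℤ) ∣ (n' : ℤ) := by exact_mod_cast hn'
    have hmul {a b : ℤ} (ha : ¬ (p : ℤ) ∣ a) (hb : ¬ (p : ℤ) ∣ b) : ¬ (p : ℤ) ∣ a * b :=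
      fun hd => (hpi.dvd_or_dvd hd).elim ha hb
    exact hmul (hmul (hmul (hmul (hpow _ _ hx) (hpow _ _ hy)) hVfp) (hpow _ _ hg)) hn''
  · have hwQ : (x : ℚ) ^ n * y ^ (n * p) * Ve - x ^ (n * p) * y ^ n * Vf = p ^ (k + 1) * w := by
      exact_mod_cast hw
    have hnQ : (n : ℚ) = p ^ k * n' := by
      rw [hndef]
      push_cast
      rfl
    push_cast
    rw [hnQ]
    linear_combination (n' : ℚ) * g ^ (n + 1) * hrel +
      (x ^ n * y ^ (n * p) * Ve - x ^ (n * p) * y ^ n * Vf) * (n' : ℚ) * hw₀ + w₀ * n' * hwQ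

theorem IsFactorial.hasGaussProperty {r : ℕ} {α β : Fin r → ℚ}
    (hβ : ∀ i (m : ℕ), β i ≠ -(m : ℚ))
    (hF : IsGloballyBounded ((hypSeries α β).map (algebraMap ℚ ℂ)))
    (h : IsFactorial (hypSeries α β))
    (K : Type*) [Field K] [NumberField K] [IsGalois ℚ K] :
    HasGaussProperty
      (((hypSeries α β).map (algebraMap ℚ K) : PowerSeries K) : LaurentSeries K) := by
  obtain ⟨C, hC, u, v, e, f, he, hf, h⟩ := h
  obtain ⟨g, hg0, hg⟩ := hF.exists_intCast
  have hcoeff (n : ℕ) : PowerSeries.coeff n (hypSeries α β) = hypCoeff α β n := by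
    simp [hypSeries]
  have h' (n : ℕ) : C ^ n * hypCoeff α β n =
      (∏ i, ((e i * n)! : ℚ)) / ∏ j, ((f j * n)! : ℚ) := by
    have := congrArg (PowerSeries.coeff n) h
    rwa [PowerSeries.coeff_rescale, hcoeff, PowerSeries.coeff_mk] at this
  have hsum := sum_eq_sum_of_hypCoeff_eq hβ hC he hf h'
  have hx : C.num ≠ 0 := Rat.num_ne_zero.2 hC
  have hy : (C.den : ℤ) ≠ 0 := by exact_mod_cast C.den_nz
  filter_upwards [eventually_isUnramified,
    eventually_not_residueChar_dvd _ (mul_ne_zero (mul_ne_zero hx hy) hg0)] with 𝔭 hur hB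
  refine ⟨hur, gaussCongruences_of _ _ fun n hn => ?_⟩
  simp only [hcoeff] at hg ⊢
  refine gauss_congruence_of_factorial hy hsum (fun n => ?_) hg (residueChar_prime 𝔭) hB hn
  rw [Int.cast_natCast, Rat.num_div_den, h']

end GloballyBounded

/-! ### Products along arithmetic progressions modulo `p` -/

section ArithmeticProgressions

/-- The product `a (a + d) ⋯ (a + (n - 1) d)`. -/
def progressionProd (d : ℕ) (a : ℤ) (n : ℕ) : ℤ := ∏ j ∈ Finset.range n, (a + j * d)

theorem progressionProd_succ (d : ℕ) (a : ℤ) (n : ℕ) :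
    progressionProd d a (n + 1) = progressionProd d a n * (a + n * d) :=
  Finset.prod_range_succ _ _

theorem progressionProd_ne_zero {d : ℕ} {a : ℤ} (h : ∀ j : ℕ, a + j * d ≠ 0) (n : ℕ) :
    progressionProd d a n ≠ 0 :=
  Finset.prod_ne_zero_iff.2 fun j _ => h j

theorem eval_ascPochhammer_div {d : ℕ} (hd : 0 < d) (a : ℤ) (n : ℕ) :
    (ascPochhammer ℚ n).eval ((a : ℚ) / d) = progressionProd d a n / (d : ℚ) ^ n := by
  induction n with
  | zero => simp [progressionProd]
  | succ n ih =>
    rw [ascPochhammer_succ_eval, ih, progressionProd_succ]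
    push_cast
    field_simp
    ring

theorem hypCoeff_div {d : ℕ} (hd : 0 < d) {r : ℕ} (a b : Fin r → ℤ) (n : ℕ) :
    hypCoeff (fun i => (a i : ℚ) / d) (fun i => (b i : ℚ) / d) n =
      (∏ i, (progressionProd d (a i) n : ℚ)) / ∏ i, (progressionProd d (b i) n : ℚ) := by
  have hd' : (d : ℚ) ≠ 0 := by exact_mod_cast hd.ne'
  simp only [hypCoeff, eval_ascPochhammer_div hd, Finset.prod_div_distrib]
  rw [div_div_div_cancel_right₀ (by simp [hd'])]

/-- The product of the nonzero residues modulo `p`. -/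
noncomputable def nonzeroResidueProd (p : ℕ) [Fact p.Prime] : ZMod p :=
  ∏ x ∈ Finset.univ.erase (0 : ZMod p), x

theorem nonzeroResidueProd_ne_zero (p : ℕ) [Fact p.Prime] : nonzeroResidueProd p ≠ 0 :=
  Finset.prod_ne_zero_iff.2 fun _ h => Finset.ne_of_mem_erase h

theorem prod_erase_eq_nonzeroResidueProd {p : ℕ} [hp : Fact p.Prime] {a d : ZMod p} (hd : d ≠ 0)
    {k : ℕ} (hk : k < p) (hak : a + k * d = 0) :
    ∏ s ∈ (Finset.range p).erase k, (a + s * d) = nonzeroResidueProd p := by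
  have hcast {s t : ℕ} (hs : s < p) (ht : t < p) (h : (s : ZMod p) = t) : s = t := by
    rw [← ZMod.val_cast_of_lt hs, ← ZMod.val_cast_of_lt ht, h]
  refine Finset.prod_bij' (fun s _ => a + s * d) (fun x _ => ((x - a) / d).val) ?_ ?_ ?_ ?_ ?_
  · intro s hs
    rw [Finset.mem_erase, Finset.mem_range] at hs
    refine Finset.mem_erase.2 ⟨fun h => hs.1 (hcast hs.2 hk ?_), Finset.mem_univ _⟩
    exact mul_right_cancel₀ hd (by linear_combination h - hak)
  · intro x hx
    refine Finset.mem_erase.2 ⟨fun h => Finset.ne_of_mem_erase hx ?_,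
      Finset.mem_range.2 (ZMod.val_lt _)⟩
    rw [← hak, ← h, ZMod.natCast_zmod_val]
    field_simp
    ring
  · intro s hs
    rw [Finset.mem_erase, Finset.mem_range] at hs
    rw [add_sub_cancel_left, mul_div_cancel_right₀ _ hd, ZMod.val_cast_of_lt hs.2]
  · intro x hx
    rw [ZMod.natCast_zmod_val]
    field_simp
    ring
  · intro s _
    rfl

/-- In each block of `p` consecutive terms exactly one, at offset `k`, is divisible by `p`; in block
`n` it equals `p (a' + n d)`. The others run over all nonzero residues. -/
theorem progressionProd_mul_prime {p : ℕ} [hp : Fact p.Prime] {d : ℕ} (hd : ¬ p ∣ d) {a a' : ℤ}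
    {k : ℕ} (hk : k < p) (h : p * a' = a + k * d) (n : ℕ) :
    ∃ U : ℤ, progressionProd d a (n * p) = p ^ n * progressionProd d a' n * U ∧
      (U : ZMod p) = nonzeroResidueProd p ^ n := by
  induction n with
  | zero => exact ⟨1, by simp [progressionProd], by simp⟩
  | succ n ih =>
    obtain ⟨U, hU, hU'⟩ := ih
    refine ⟨U * ∏ s ∈ (Finset.range p).erase k, (a + (n * p + s) * d), ?_, ?_⟩
    · have hblock : ∏ s ∈ Finset.range p, (a + ((n * p + s : ℕ) : ℤ) * d) =
          p * (a' + n * d) * ∏ s ∈ (Finset.range p).erase k, (a + (n * p + s) * d) := by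
        rw [← Finset.mul_prod_erase _ _ (Finset.mem_range.2 hk)]
        push_cast
        congr 1
        linear_combination -h
      rw [progressionProd_succ, progressionProd, add_mul, one_mul, Finset.prod_range_add, hblock,
        ← progressionProd, hU]
      ring
    · push_cast
      rw [hU', pow_succ]
      congr 1
      have hd0 : (d : ZMod p) ≠ 0 := by rwa [Ne, ZMod.natCast_eq_zero_iff]
      have hak : (a : ZMod p) + k * d = 0 := by
        have := congrArg (Int.cast : ℤ → ZMod p) h
        push_cast at this
        rw [← this, ZMod.natCast_self, zero_mul]
      rw [← prod_erase_eq_nonzeroResidueProd hd0 hk hak]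
      simp

/-- The representative in `[1, d]` of a residue class modulo `d`. -/
def positiveRep (d : ℕ) (x : ZMod d) : ℤ := ((x - 1).val : ℤ) + 1

theorem positiveRep_cast {d : ℕ} [NeZero d] (x : ZMod d) : (positiveRep d x : ZMod d) = x := by
  simp [positiveRep]

theorem positiveRep_mem {d : ℕ} [NeZero d] (x : ZMod d) :
    1 ≤ positiveRep d x ∧ positiveRep d x ≤ d := by
  have := ZMod.val_lt (x - 1)
  unfold positiveRep
  omega

theorem positiveRep_eq_iff {d : ℕ} [NeZero d] (x : ZMod d) (k : ℤ) :
    positiveRep d x = k ↔ (1 ≤ k ∧ k ≤ d) ∧ (k : ZMod d) = x := by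
  constructor
  · rintro rfl
    exact ⟨positiveRep_mem x, positiveRep_cast x⟩
  · rintro ⟨⟨h1, h2⟩, rfl⟩
    obtain ⟨h3, h4⟩ := positiveRep_mem (k : ZMod d)
    obtain ⟨c, hc⟩ := (ZMod.intCast_eq_intCast_iff_dvd_sub _ _ d).1 (positiveRep_cast (k : ZMod d))
    have hc1 : c < 1 := by
      by_contra hcon
      nlinarith
    have hc2 : -1 < c := by
      by_contra hcon
      nlinarith
    obtain rfl : c = 0 := by omega
    linarith

/-- Supplies the offset `k` and the new parameter `a'` for `progressionProd_mul_prime`: `p a' ≡ a`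
mod `d`, and the size of `p` places the quotient in `[0, p)`. -/
theorem exists_prime_mul_positiveRep_eq {d : ℕ} [NeZero d] {a : ℤ}
    (ha : ∀ m : ℕ, a + m * d ≠ 0) {p : ℕ} (hp : d + a.natAbs < p) {w : ZMod d}
    (hw : (p : ZMod d) * w = 1) :
    ∃ k < p, (p : ℤ) * positiveRep d (w * a) = a + k * d := by
  have hd : 0 < d := NeZero.pos d
  obtain ⟨h1, h2⟩ := positiveRep_mem (w * (a : ZMod d))
  have hcast := positiveRep_cast (w * (a : ZMod d))
  set a' := positiveRep d (w * (a : ZMod d))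
  have hdvd : (d : ℤ) ∣ p * a' - a := by
    rw [← ZMod.intCast_zmod_eq_zero_iff_dvd]
    push_cast
    rw [hcast, ← mul_assoc, hw, one_mul, sub_self]
  obtain ⟨c, hc⟩ := hdvd
  have habs : (d : ℤ) + |a| < p := by
    rw [Int.abs_eq_natAbs]
    exact_mod_cast hp
  have ha1 := le_abs_self a
  have ha2 := neg_abs_le a
  have hc0 : 0 ≤ c := by
    by_contra hcon
    nlinarith
  lift c to ℕ using hc0
  refine ⟨c, ?_, by linarith⟩
  by_contra! hcp
  have hcp' : (p : ℤ) ≤ c := by exact_mod_cast hcp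
  have hge : (p : ℤ) * d ≤ p * a' - a := by nlinarith
  -- If `a' < d`, then `p ≤ -a`, against the size of `p`. If `a' = d`, then `a` is a nonpositive
  -- multiple of `d`, which `ha` excludes.
  rcases h2.lt_or_eq with h2 | h2
  · nlinarith
  · have hle : a ≤ 0 := by
      rw [h2] at hge
      linarith
    have hda : (d : ℤ) ∣ a := ⟨p - c, by rw [h2] at hc; linarith⟩
    obtain ⟨m, hm⟩ := hda
    have hm0 : m ≤ 0 := by
      by_contra hcon
      nlinarith
    obtain ⟨l, hl⟩ := Int.eq_ofNat_of_zero_le (a := -m) (by omega)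
    exact ha l (by rw [hm, ← hl]; ring)

end ArithmeticProgressions

/-! ### From Cartier congruences to an equality of multisets -/

section CartierToIdentity

theorem prod_progressionProd_mul_prime {p : ℕ} [hp : Fact p.Prime] {d : ℕ} (hd : ¬ p ∣ d) {r : ℕ}
    {a a' : Fin r → ℤ} (h : ∀ i, ∃ k < p, p * a' i = a i + (k : ℕ) * d) (n : ℕ) :
    ∃ U : ℤ, ∏ i, progressionProd d (a i) (n * p) =
        p ^ (n * r) * (∏ i, progressionProd d (a' i) n) * U ∧
      (U : ZMod p) = nonzeroResidueProd p ^ (n * r) := by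
  choose k hk hka using h
  choose U hU hU' using fun i => progressionProd_mul_prime hd (hk i) (hka i) n
  refine ⟨∏ i, U i, ?_, ?_⟩
  · simp only [hU, Finset.prod_mul_distrib, Finset.prod_const, Finset.card_univ, Fintype.card_fin,
      pow_mul]
  · push_cast
    simp only [hU', Finset.prod_const, Finset.card_univ, Fintype.card_fin, pow_mul]

/-- Numerator and denominator have the same number `r` of parameters, so the powers of `p` cancel
exactly and both unit parts reduce to the same invertible residue. -/
theorem prime_dvd_of_cartier {p : ℕ} [hp : Fact p.Prime] {d : ℕ} (hd : 0 < d) (hpd : ¬ p ∣ d)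
    {r : ℕ} {a b a' b' : Fin r → ℤ} (hb : ∀ i (m : ℕ), b i + m * d ≠ 0)
    (ha : ∀ i, ∃ k < p, p * a' i = a i + (k : ℕ) * d)
    (hb' : ∀ i, ∃ k < p, p * b' i = b i + (k : ℕ) * d) (n : ℕ)
    (h : ∃ s w : ℤ, ¬ (p : ℤ) ∣ s ∧
      (hypCoeff (fun i => (a i : ℚ) / d) (fun i => (b i : ℚ) / d) (n * p) -
        hypCoeff (fun i => (a i : ℚ) / d) (fun i => (b i : ℚ) / d) n) * s = p * w) :
    (p : ℤ) ∣ (∏ i, progressionProd d (a' i) n) * (∏ i, progressionProd d (b i) n) -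
      (∏ i, progressionProd d (a i) n) * ∏ i, progressionProd d (b' i) n := by
  obtain ⟨s, w, hs, h⟩ := h
  obtain ⟨U, hU, hU'⟩ := prod_progressionProd_mul_prime hpd ha n
  obtain ⟨V, hV, hV'⟩ := prod_progressionProd_mul_prime hpd hb' n
  have hpZ : (p : ℤ) ≠ 0 := by exact_mod_cast hp.out.ne_zero
  have hM' : ∏ i, progressionProd d (b i) (n * p) ≠ 0 :=
    Finset.prod_ne_zero_iff.2 fun i _ => progressionProd_ne_zero (hb i) _
  have hM : ∏ i, progressionProd d (b i) n ≠ 0 :=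
    Finset.prod_ne_zero_iff.2 fun i _ => progressionProd_ne_zero (hb i) _
  rw [hypCoeff_div hd, hypCoeff_div hd, ← Int.cast_prod, ← Int.cast_prod, ← Int.cast_prod,
    ← Int.cast_prod] at h
  rw [hV] at hM'
  rw [hU, hV] at h
  set N' := ∏ i, progressionProd d (a' i) n
  set N := ∏ i, progressionProd d (a i) n
  set M' := ∏ i, progressionProd d (b' i) n
  set M := ∏ i, progressionProd d (b i) n
  have hrel : s * (N' * U * M - N * (M' * V)) = p * (w * (M' * V) * M) := by
    have hM'Q : (M' : ℚ) ≠ 0 := by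
      rw [Int.cast_ne_zero]
      rintro h0
      simp [h0] at hM'
    have hVQ : (V : ℚ) ≠ 0 := by
      rw [Int.cast_ne_zero]
      rintro h0
      simp [h0] at hM'
    have hMQ : (M : ℚ) ≠ 0 := by exact_mod_cast hM
    have hpQ : (p : ℚ) ≠ 0 := by exact_mod_cast hpZ
    push_cast at h
    field_simp at h
    have h2 : ((s * (N' * U * M - N * (M' * V)) : ℤ) : ℚ) =
        ((p * (w * (M' * V) * M) : ℤ) : ℚ) := by
      push_cast
      linear_combination h
    exact_mod_cast h2
  have hdvd := ((Nat.prime_iff_prime_int.1 hp.out).dvd_or_dvd (Dvd.intro _ hrel.symm)).resolve_left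
    hs
  rw [← ZMod.intCast_zmod_eq_zero_iff_dvd] at hdvd ⊢
  push_cast at hdvd ⊢
  rw [hU', hV'] at hdvd
  refine mul_left_cancel₀ (pow_ne_zero (n * r) (nonzeroResidueProd_ne_zero p)) ?_
  linear_combination hdvd

theorem prod_progressionProd_eq_of_cartier {d : ℕ} [NeZero d] {r : ℕ} {a b : Fin r → ℤ}
    (ha : ∀ i (m : ℕ), a i + m * d ≠ 0) (hb : ∀ i (m : ℕ), b i + m * d ≠ 0)
    (h : ∃ N : ℕ, ∀ p : ℕ, p.Prime → N < p → ∀ n : ℕ, ∃ s w : ℤ, ¬ (p : ℤ) ∣ s ∧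
      (hypCoeff (fun i => (a i : ℚ) / d) (fun i => (b i : ℚ) / d) (n * p) -
        hypCoeff (fun i => (a i : ℚ) / d) (fun i => (b i : ℚ) / d) n) * s = p * w)
    (w : (ZMod d)ˣ) (n : ℕ) :
    (∏ i, progressionProd d (positiveRep d (w * a i)) n) * (∏ i, progressionProd d (b i) n) =
      (∏ i, progressionProd d (a i) n) *
        ∏ i, progressionProd d (positiveRep d (w * b i)) n := by
  obtain ⟨N, h⟩ := h
  rw [← sub_eq_zero]
  set D := (∏ i, progressionProd d (positiveRep d (w * a i)) n) *
    (∏ i, progressionProd d (b i) n) - (∏ i, progressionProd d (a i) n) *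
        ∏ i, progressionProd d (positiveRep d (w * b i)) n
  -- `D` does not involve `p`, so a prime in the class of `w⁻¹` larger than `|D|` and dividing `D`
  -- forces `D = 0`.
  obtain ⟨p, hlt, hp, hpw⟩ := Nat.forall_exists_prime_gt_and_eq_mod (q := d) (w⁻¹).isUnit
    (N + D.natAbs + d + ∑ i, (a i).natAbs + ∑ i, (b i).natAbs)
  have := Fact.mk hp
  have hpw' : (p : ZMod d) * w = 1 := by rw [hpw, Units.inv_mul]
  have hpd : ¬ p ∣ d := fun hd => by
    have := Nat.le_of_dvd (NeZero.pos d) hd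
    omega
  have hsum (c : Fin r → ℤ) (i : Fin r) : (c i).natAbs ≤ ∑ i, (c i).natAbs :=
    Finset.single_le_sum (f := fun i => (c i).natAbs) (fun _ _ => Nat.zero_le _)
      (Finset.mem_univ i)
  have hdvd := prime_dvd_of_cartier (NeZero.pos d) hpd hb
    (fun i => exists_prime_mul_positiveRep_eq (ha i) (by have := hsum a i; omega) hpw')
    (fun i => exists_prime_mul_positiveRep_eq (hb i) (by have := hsum b i; omega) hpw') n
    (h p hp (by omega) n)
  exact Int.eq_zero_of_dvd_of_natAbs_lt_natAbs hdvd (by rw [Int.natAbs_natCast]; omega)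

open Polynomial in
-- Dividing the identity at `n + 1` by the one at `n` gives `∏ (a i + n d) = ∏ (b i + n d)`: two
-- polynomials agree at infinitely many points, hence have the same roots.
theorem map_eq_map_of_prod_progressionProd_eq {d : ℕ} (hd : 0 < d) {ι : Type*} [Fintype ι]
    {a b : ι → ℤ} (hb : ∀ i (m : ℕ), b i + m * d ≠ 0)
    (h : ∀ n, ∏ i, progressionProd d (a i) n = ∏ i, progressionProd d (b i) n) :
    (Finset.univ.val.map a : Multiset ℤ) = Finset.univ.val.map b := by
  have hpoly : ∏ i, (X - C (-a i)) = ∏ i, (X - C (-b i)) := by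
    refine eq_of_infinite_eval_eq _ _ ((Set.infinite_range_of_injective
      (f := fun n : ℕ => (n : ℤ) * d) fun m n hmn => ?_).mono ?_)
    · exact_mod_cast mul_right_cancel₀ (by exact_mod_cast hd.ne') hmn
    · rintro _ ⟨n, rfl⟩
      have h1 := h (n + 1)
      simp only [progressionProd_succ, Finset.prod_mul_distrib] at h1
      rw [h n] at h1
      have h2 := mul_left_cancel₀
        (Finset.prod_ne_zero_iff.2 fun i _ => progressionProd_ne_zero (hb i) n) h1
      simp only [Set.mem_ofPred_eq, eval_prod, eval_sub, eval_X, eval_C, sub_neg_eq_add]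
      simpa only [add_comm] using h2
  have hroots (c : ι → ℤ) : (∏ i, (X - C (-c i))).roots = Finset.univ.val.map fun i => -c i := by
    rw [← roots_multiset_prod_X_sub_C (Finset.univ.val.map fun i => -c i), Multiset.map_map]
    rfl
  have h3 := hroots a
  rw [hpoly, hroots b] at h3
  have h4 := congrArg (Multiset.map fun x : ℤ => -x) h3
  simp only [Multiset.map_map, Function.comp_def, neg_neg] at h4
  exact h4.symm

end CartierToIdentity

/-! ### Building factorial ratios by Möbius inversion -/

section FactorialRatios

/-- Sequences `g` with `Cⁿ g n = ∏ (eᵢ n)! / ∏ (fⱼ n)!` for some `C ≠ 0` and positive `eᵢ`, `fⱼ`. -/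
def IsFactorialRatio (g : ℕ → ℚ) : Prop :=
  ∃ C : ℚ, C ≠ 0 ∧ ∃ (u v : ℕ) (e : Fin u → ℕ) (f : Fin v → ℕ),
    (∀ i, 0 < e i) ∧ (∀ j, 0 < f j) ∧
    ∀ n, C ^ n * g n = (∏ i, ((e i * n)! : ℚ)) / (∏ j, ((f j * n)! : ℚ))

theorem IsFactorialRatio.one : IsFactorialRatio 1 :=
  ⟨1, one_ne_zero, 0, 0, Fin.elim0, Fin.elim0, fun i => i.elim0, fun i => i.elim0, by simp⟩

theorem IsFactorialRatio.mul {g h : ℕ → ℚ} (hg : IsFactorialRatio g) (hh : IsFactorialRatio h) :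
    IsFactorialRatio (g * h) := by
  obtain ⟨C, hC, u, v, e, f, he, hf, hg⟩ := hg
  obtain ⟨D, hD, u', v', e', f', he', hf', hh⟩ := hh
  refine ⟨C * D, mul_ne_zero hC hD, u + u', v + v', Fin.append e e', Fin.append f f', ?_, ?_, ?_⟩
  · exact fun i => Fin.addCases (fun j => by simpa using he j) (fun j => by simpa using he' j) i
  · exact fun i => Fin.addCases (fun j => by simpa using hf j) (fun j => by simpa using hf' j) i
  · intro n
    simp only [Fin.prod_univ_add, Fin.append_left, Fin.append_right, Pi.mul_apply]
    rw [mul_div_mul_comm, ← hg, ← hh]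
    ring

theorem IsFactorialRatio.inv {g : ℕ → ℚ} (hg : IsFactorialRatio g) : IsFactorialRatio g⁻¹ := by
  obtain ⟨C, hC, u, v, e, f, he, hf, hg⟩ := hg
  refine ⟨C⁻¹, inv_ne_zero hC, v, u, f, e, hf, he, fun n => ?_⟩
  rw [← inv_div, ← hg, Pi.inv_apply, inv_pow, mul_inv]

theorem IsFactorialRatio.pow {g : ℕ → ℚ} (hg : IsFactorialRatio g) (m : ℕ) :
    IsFactorialRatio (g ^ m) := by
  induction m with
  | zero => simpa using IsFactorialRatio.one
  | succ m ih => rw [pow_succ]; exact ih.mul hg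

theorem IsFactorialRatio.zpow {g : ℕ → ℚ} (hg : IsFactorialRatio g) (m : ℤ) :
    IsFactorialRatio (g ^ m) := by
  obtain ⟨m, rfl | rfl⟩ := m.eq_nat_or_neg
  · simpa using hg.pow m
  · simpa using (hg.pow m).inv

theorem IsFactorialRatio.prod {ι : Type*} (s : Finset ι) {g : ι → ℕ → ℚ}
    (hg : ∀ i ∈ s, IsFactorialRatio (g i)) : IsFactorialRatio (∏ i ∈ s, g i) :=
  Finset.prod_induction _ _ (fun _ _ => IsFactorialRatio.mul) IsFactorialRatio.one hg

/-- The terms `h (j + 1) + t h e = h (e t + j + 1)`, for `j < e` and `t < n`, are `h` times the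
integers from `1` to `e n`. -/
theorem prod_progressionProd_multiples {h e : ℕ} (hh : 0 < h) (n : ℕ) :
    ∏ k ∈ (Finset.Icc 1 (h * e)).filter (h ∣ ·), progressionProd (h * e) (k : ℕ) n =
      h ^ (e * n) * ((e * n)! : ℤ) := by
  have himage : (Finset.Icc 1 (h * e)).filter (h ∣ ·) =
      (Finset.range e).image fun j => h * (j + 1) := by
    ext k
    simp only [Finset.mem_filter, Finset.mem_Icc, Finset.mem_image, Finset.mem_range]
    constructor
    · rintro ⟨⟨h1, h2⟩, j, rfl⟩
      have hj : 0 < j := Nat.pos_of_ne_zero (by rintro rfl; simp at h1)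
      have hje : j ≤ e := Nat.le_of_mul_le_mul_left h2 hh
      exact ⟨j - 1, by omega, by rw [Nat.sub_add_cancel hj]⟩
    · rintro ⟨j, hj, rfl⟩
      exact ⟨⟨Nat.mul_pos hh j.succ_pos, Nat.mul_le_mul_left h hj⟩, dvd_mul_right _ _⟩
  rw [himage, Finset.prod_image fun i _ j _ hij => by
    have := Nat.eq_of_mul_eq_mul_left hh hij
    omega]
  induction n with
  | zero => simp [progressionProd]
  | succ n ih =>
    have hlin (j : ℕ) : ((h * (j + 1) : ℕ) : ℤ) + n * ((h * e : ℕ) : ℤ) =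
        h * ((e * n + j + 1 : ℕ) : ℤ) := by
      push_cast
      ring
    simp only [progressionProd_succ, Finset.prod_mul_distrib, ih, hlin, factorial_mul_succ]
    simp only [Finset.prod_const, Finset.card_range]
    push_cast
    ring

theorem isFactorialRatio_prod_multiples {d h : ℕ} (hd : 0 < d) (hdvd : h ∣ d) :
    IsFactorialRatio fun n =>
      ∏ k ∈ (Finset.Icc 1 d).filter (h ∣ ·), (progressionProd d (k : ℕ) n : ℚ) := by
  obtain ⟨e, rfl⟩ := hdvd
  have hh : 0 < h := Nat.pos_of_mul_pos_right hd
  have he : 0 < e := Nat.pos_of_mul_pos_left hd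
  refine ⟨((h : ℚ) ^ e)⁻¹, by positivity, 1, 0, fun _ => e, Fin.elim0, fun _ => he,
    fun i => i.elim0, fun n => ?_⟩
  beta_reduce
  rw [← Int.cast_prod, prod_progressionProd_multiples hh]
  have : (h : ℚ) ≠ 0 := by positivity
  simp
  field_simp
  rw [pow_mul]

theorem zpow_sum₀ {G ι : Type*} [CommGroupWithZero G] {x : G} (hx : x ≠ 0) (s : Finset ι)
    (f : ι → ℤ) : x ^ (∑ i ∈ s, f i) = ∏ i ∈ s, x ^ f i := by
  classical
  induction s using Finset.induction_on with
  | empty => simp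
  | insert i s hi ih => rw [Finset.sum_insert hi, Finset.prod_insert hi, zpow_add₀ hx, ih]

/-- Writing `m(t) = ∑ b(h)` over `h ∣ t` and exchanging the products groups the factors into
products over multiples of `h`, each with exponent `b(h)`. -/
theorem isFactorialRatio_prod_zpow {d : ℕ} (hd : 0 < d) (m : ℕ → ℤ)
    (hm : ∀ k ∈ Finset.Icc 1 d, m k = m (k.gcd d)) :
    IsFactorialRatio fun n => ∏ k ∈ Finset.Icc 1 d, (progressionProd d (k : ℕ) n : ℚ) ^ m k := by
  obtain ⟨b, hb⟩ : ∃ b : ℕ → ℤ, ∀ t > 0, ∑ h ∈ t.divisors, b h = m t :=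
    ⟨_, ArithmeticFunction.sum_eq_iff_sum_mul_moebius_eq.2 fun n _ => rfl⟩
  have hne (k n : ℕ) (hk : k ∈ Finset.Icc 1 d) : (progressionProd d (k : ℕ) n : ℚ) ≠ 0 := by
    have := (Finset.mem_Icc.1 hk).1
    exact_mod_cast progressionProd_ne_zero (fun j => by positivity) n
  have hfun : (fun n => ∏ k ∈ Finset.Icc 1 d, (progressionProd d (k : ℕ) n : ℚ) ^ m k) =
      ∏ h ∈ d.divisors, (fun n =>
        ∏ k ∈ (Finset.Icc 1 d).filter (h ∣ ·), (progressionProd d (k : ℕ) n : ℚ)) ^ b h := by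
    ext n
    simp only [Finset.prod_apply, Pi.pow_apply, ← Finset.prod_zpow, Finset.prod_filter]
    rw [Finset.prod_comm]
    refine Finset.prod_congr rfl fun k hk => ?_
    have hset : (k.gcd d).divisors = d.divisors.filter (· ∣ k) := by
      ext h
      simp only [Nat.mem_divisors, Finset.mem_filter, Nat.dvd_gcd_iff]
      have := (Nat.gcd_pos_of_pos_right k hd).ne'
      have := hd.ne'
      tauto
    rw [hm k hk, ← hb _ (Nat.gcd_pos_of_pos_right k hd), hset, zpow_sum₀ (hne k n hk),
      Finset.prod_filter]
    refine Finset.prod_congr rfl fun h _ => ?_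
    split_ifs <;> simp
  rw [hfun]
  exact IsFactorialRatio.prod _ fun h hh =>
    (isFactorialRatio_prod_multiples hd (Nat.dvd_of_mem_divisors hh)).zpow _

end FactorialRatios

/-! ### Unit invariance of the multiplicities -/

section Multiplicities

open Finset in
theorem prod_progressionProd_eq_prod_pow {d r : ℕ} (a : Fin r → ℤ) {s : Finset ℤ}
    (hs : ∀ i, a i ∈ s) (n : ℕ) :
    ∏ i, (progressionProd d (a i) n : ℚ) =
      ∏ k ∈ s, (progressionProd d k n : ℚ) ^ #{i | a i = k} := by
  rw [← prod_fiberwise_of_maps_to (s := univ) (t := s) (g := a) fun i _ => hs i]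
  refine prod_congr rfl fun k _ => ?_
  rw [prod_congr rfl fun i hi => by rw [(mem_filter.1 hi).2], prod_const]

open Finset in
theorem isFactorialRatio_hypCoeff {d : ℕ} [NeZero d] {r : ℕ} {a b : Fin r → ℤ}
    (ha : ∀ i (m : ℕ), a i + m * d ≠ 0) (hb : ∀ i (m : ℕ), b i + m * d ≠ 0)
    (h : ∃ N : ℕ, ∀ p : ℕ, p.Prime → N < p → ∀ n : ℕ, ∃ s w : ℤ, ¬ (p : ℤ) ∣ s ∧
      (hypCoeff (fun i => (a i : ℚ) / d) (fun i => (b i : ℚ) / d) (n * p) -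
        hypCoeff (fun i => (a i : ℚ) / d) (fun i => (b i : ℚ) / d) n) * s = p * w) :
    IsFactorialRatio (hypCoeff (fun i => (a i : ℚ) / d) fun i => (b i : ℚ) / d) := by
  have hd : 0 < d := NeZero.pos d
  set m : ℤ → ℤ := fun k => #{i | a i = k} - #{i | b i = k} with hm
  set M : ZMod d → ℤ := fun x => #{i | (a i : ZMod d) = x} - #{i | (b i : ZMod d) = x} with hM
  have hpos (x : ZMod d) (j : ℕ) : positiveRep d x + j * d ≠ 0 := by
    have := (positiveRep_mem x).1
    positivity
  -- Counts `k` in the multiset equality for `w`. Taking `w = 1` shows that parameters outside `[1,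
  -- d]` cancel; varying `w` gives invariance under units.
  have hmM (w : (ZMod d)ˣ) (k : ℤ) :
      m k = if 1 ≤ k ∧ k ≤ d then M (((w⁻¹ : (ZMod d)ˣ) : ZMod d) * k) else 0 := by
    have hmap := map_eq_map_of_prod_progressionProd_eq hd
      (a := Sum.elim (fun i => positiveRep d (w * a i)) b)
      (b := Sum.elim a fun i => positiveRep d (w * b i))
      (by
        rintro (i | i) j
        · exact ha i j
        · exact hpos _ j)
      (by
        intro n
        simp only [Fintype.prod_sum_type, Sum.elim_inl, Sum.elim_inr]
        exact prod_progressionProd_eq_of_cartier ha hb h w n)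
    have hcount := congrArg (Multiset.count k) hmap
    have hcnt (c c' : Fin r → ℤ) : Multiset.count k (univ.val.map (Sum.elim c c')) =
        #{i | c i = k} + #{i | c' i = k} := by
      rw [Multiset.count_map, ← filter_val, card_val, card_filter, card_filter, card_filter,
        Fintype.sum_sum_type]
      simp only [eq_comm (a := k), Sum.elim_inl, Sum.elim_inr]
    rw [hcnt, hcnt] at hcount
    have hrep (c : Fin r → ℤ) : #{i | positiveRep d (w * c i) = k} = if 1 ≤ k ∧ k ≤ d then
        #{i | (c i : ZMod d) = ((w⁻¹ : (ZMod d)ˣ) : ZMod d) * k} else 0 := by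
      simp only [positiveRep_eq_iff]
      split_ifs with hk
      · congr 1
        ext i
        simp only [hk, mem_filter, mem_univ, true_and, Units.eq_inv_mul_iff_mul_eq]
        exact eq_comm
      · simp [hk]
    rw [hrep, hrep] at hcount
    simp only [hm, hM]
    split_ifs at hcount ⊢ <;> omega
  have hm0 (k : ℤ) (hk : k ∉ Icc (1 : ℤ) d) : m k = 0 := by
    rw [hmM 1, if_neg (by rwa [mem_Icc] at hk)]
  have hgcd (k : ℕ) (hk : k ∈ Icc 1 d) : m k = m (k.gcd d : ℕ) := by
    rw [mem_Icc] at hk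
    have hg : 0 < k.gcd d := Nat.gcd_pos_of_pos_right k hd
    have hgd : k.gcd d ≤ d := Nat.le_of_dvd hd (Nat.gcd_dvd_right k d)
    -- `k / gcd` is a unit modulo `d / gcd`, and units lift along `ZMod d → ZMod (d / gcd)`.
    obtain ⟨u, hu⟩ : ∃ u : (ZMod d)ˣ, (u : ZMod d) * (k.gcd d : ℕ) = k := by
      have hcop := Nat.coprime_div_gcd_div_gcd hg
      obtain ⟨u, hu⟩ := ZMod.unitsMap_surjective (Nat.div_dvd_of_dvd (Nat.gcd_dvd_right k d))
        (ZMod.unitOfCoprime _ hcop)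
      refine ⟨u, ?_⟩
      have hu' := congrArg Units.val hu
      rw [ZMod.unitsMap_val, ZMod.coe_unitOfCoprime] at hu'
      have hmod : (u : ZMod d).val ≡ k / k.gcd d [MOD d / k.gcd d] := by
        rw [← ZMod.natCast_eq_natCast_iff, ← hu', ZMod.natCast_val]
      have hmod' := hmod.mul_right' (k.gcd d)
      rw [Nat.div_mul_cancel (Nat.gcd_dvd_left k d), Nat.div_mul_cancel (Nat.gcd_dvd_right k d),
        ← ZMod.natCast_eq_natCast_iff] at hmod'
      rw [← hmod']
      push_cast
      rw [ZMod.natCast_zmod_val]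
    -- Both multiplicities become `M k`: the first directly, the second through `u * gcd = k`.
    rw [hmM 1, hmM u⁻¹, if_pos (by omega), if_pos (by omega), inv_inv, Int.cast_natCast,
      Int.cast_natCast, hu, inv_one, Units.val_one, one_mul]
  have hfun : hypCoeff (fun i => (a i : ℚ) / d) (fun i => (b i : ℚ) / d) =
      fun n => ∏ k ∈ Icc 1 d, (progressionProd d (k : ℕ) n : ℚ) ^ m k := by
    ext n
    set s := univ.image a ∪ univ.image b ∪ Icc (1 : ℤ) d
    have hne (k : ℤ) (hk : k ∈ s) : (progressionProd d k n : ℚ) ≠ 0 := by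
      rw [Int.cast_ne_zero]
      refine progressionProd_ne_zero (fun j => ?_) n
      simp only [s, mem_union, mem_image, mem_univ, true_and, mem_Icc] at hk
      rcases hk with (⟨i, rfl⟩ | ⟨i, rfl⟩) | hk
      · exact ha i j
      · exact hb i j
      · have := hk.1
        positivity
    rw [hypCoeff_div hd, prod_progressionProd_eq_prod_pow a (s := s) (by simp [s]),
      prod_progressionProd_eq_prod_pow b (s := s) (by simp [s]), ← prod_div_distrib]
    have himage : (Icc 1 d).image (fun k : ℕ => (k : ℤ)) = Icc (1 : ℤ) d := by
      ext k
      simp only [mem_image, mem_Icc]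
      constructor
      · rintro ⟨k, hk, rfl⟩
        omega
      · intro hk
        exact ⟨k.toNat, by omega, by omega⟩
    rw [← prod_image (s := Icc 1 d) (g := fun k : ℕ => (k : ℤ))
      (f := fun k => (progressionProd d k n : ℚ) ^ m k) (by simp), himage]
    rw [prod_subset (subset_union_right : Icc (1 : ℤ) d ⊆ s)
      fun k _ hk => by rw [hm0 k hk, zpow_zero]]
    refine prod_congr rfl fun k hk => ?_
    rw [hm, zpow_sub₀ (hne k hk), zpow_natCast, zpow_natCast]
  rw [hfun]
  exact isFactorialRatio_prod_zpow hd (fun k => m k) hgcd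

end Multiplicities

/-! ### Cartier series are factorial, and the equivalence -/

section Main

theorem exists_common_denominator {ι : Type*} [Fintype ι] (x : ι → ℚ) :
    ∃ d : ℕ, 0 < d ∧ ∃ a : ι → ℤ, ∀ i, x i = a i / d := by
  obtain ⟨⟨d, hd⟩, h⟩ := IsLocalization.exist_integer_multiples_of_finite ℤ⁰ x
  have hd0 : d ≠ 0 := nonZeroDivisors.ne_zero hd
  choose a ha using h
  -- The common multiple `d` may be negative; its sign moves to the numerators.
  refine ⟨d.natAbs, Int.natAbs_pos.2 hd0, fun i => d.sign * a i, fun i => ?_⟩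
  have hi := ha i
  have hdQ : (d : ℚ) ≠ 0 := by exact_mod_cast hd0
  simp only [eq_intCast, zsmul_eq_mul] at hi
  rw [Int.cast_mul, hi, eq_div_iff (by positivity), ← mul_assoc, ← Int.cast_mul,
    Int.sign_mul_self_eq_abs, Nat.cast_natAbs, mul_comm]

theorem HasCartierProperty.isFactorial {r : ℕ} {α β : Fin r → ℚ}
    (hα : ∀ i (m : ℕ), α i ≠ -(m : ℚ)) (hβ : ∀ i (m : ℕ), β i ≠ -(m : ℚ))
    (K : Type*) [Field K] [NumberField K] [IsGalois ℚ K]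
    (h : HasCartierProperty
      (((hypSeries α β).map (algebraMap ℚ K) : PowerSeries K) : LaurentSeries K)) :
    IsFactorial (hypSeries α β) := by
  obtain ⟨d, hd, c, hc⟩ := exists_common_denominator (Sum.elim α β)
  have : NeZero d := ⟨hd.ne'⟩
  have hdQ : (d : ℚ) ≠ 0 := by exact_mod_cast hd.ne'
  obtain rfl : α = fun i => (c (Sum.inl i) : ℚ) / d := funext fun i => hc (Sum.inl i)
  obtain rfl : β = fun i => (c (Sum.inr i) : ℚ) / d := funext fun i => hc (Sum.inr i)
  have hne {i : Fin r ⊕ Fin r} {m : ℕ} (h : (c i : ℚ) / d ≠ -m) : c i + m * d ≠ 0 := fun h0 => h <| by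
    have h0' : (c i : ℚ) + m * d = 0 := by exact_mod_cast h0
    field_simp
    linarith
  obtain ⟨N, hN⟩ := exists_forall_prime_gt_of_eventually h
  obtain ⟨C, hC, u, v, e, f, he, hf, hR⟩ := isFactorialRatio_hypCoeff
    (a := fun i => c (Sum.inl i)) (b := fun i => c (Sum.inr i))
    (fun i m => hne (hα i m)) (fun i m => hne (hβ i m))
    ⟨N, fun p hp hlt n => by
      obtain ⟨𝔭, rfl, -, hcong⟩ := hN p hp hlt
      simpa only [hypSeries, PowerSeries.coeff_mk] using (cartierCongruences_iff _ 𝔭).1 hcong n⟩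
  refine ⟨C, hC, u, v, e, f, he, hf, ?_⟩
  ext n
  rw [PowerSeries.coeff_rescale, PowerSeries.coeff_mk, hypSeries, PowerSeries.coeff_mk, hR]

end Main

end GaussCartier

theorem mainTheorem5 {r : ℕ} (α β : Fin r → ℚ)
    (hα : ∀ (i : Fin r) (m : ℕ), α i ≠ -(m : ℚ))
    (hβ : ∀ (i : Fin r) (m : ℕ), β i ≠ -(m : ℚ))
    (hF : GaussCartier.IsGloballyBounded
      ((GaussCartier.hypSeries α β).map (algebraMap ℚ ℂ)))
    (K : Type*) [Field K] [NumberField K] [IsGalois ℚ K] :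
    List.TFAE [
      GaussCartier.IsFactorial (GaussCartier.hypSeries α β),
      GaussCartier.HasGaussProperty
        (((GaussCartier.hypSeries α β).map (algebraMap ℚ K) : PowerSeries K) : LaurentSeries K),
      GaussCartier.HasCartierProperty
        (((GaussCartier.hypSeries α β).map (algebraMap ℚ K) : PowerSeries K) :
          LaurentSeries K)] := by
  tfae_have 1 → 2 := fun h => h.hasGaussProperty hβ hF K
  tfae_have 2 → 3 := fun h => h.hasCartierProperty
  tfae_have 3 → 1 := fun h => h.isFactorial hα hβ K
  tfae_finish
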